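/- Let $H_1,H_2$ be real Hilbert spaces, let $f:H_1\to H_1$ be Lipschitz continuous, let $B:H_2\to H_1$, $C:H_1\to H_2$, $D:H_2\to H_2$ and $P:H_1\to H_1$ be bounded linear operators with $P$ symmetric and positive (that is, $\langle Px,x\rangle\ge 0$ for all $x\in H_1$), and let $\mathcal F:H_2\rightrightarrows H_2$ be a set-valued operator. Write $\mathcal F^{-1}(y)=\{x:\ y\in\mathcal F(x)\}$, $\operatorname{rge}(\mathcal F)=\bigcup_x\mathcal F(x)$, and $T$ in exponent for the adjoint. A set-valued operator $\mathcal A$ on a Hilbert space $H$ is monotone if $\langle u-v,x-y\rangle\ge 0$ for all $x,y\in H$, $u\in\mathcal A(x)$, $v\in\mathcal A(y)$, and maximal monotone if it is monotone and its graph is not strictly contained in the graph of another monotone operator. Assume: 1. the system $(f,B,C,D)$ is $P$-passive: for all $x_1,x_2\in H_1$ and $y_1,y_2\in H_2$, $$\langle P(f(x_1)-f(x_2)),x_1-x_2\rangle+\langle (PB-C^T)(y_1-y_2),x_1-x_2\rangle+\langle D(y_1-y_2),y_1-y_2\rangle\ge 0,$$ and $D$ is semi-coercive: there is $c>0$ with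 $\langle Dy,y\rangle\ge c\|y\|^2$ for all $y\in\operatorname{rge}(D+D^T)$; 2. $\mathcal F$ is maximal monotone; 3. $0\in\operatorname{ri}\bigl(\operatorname{rge}(C)-\operatorname{rge}(\mathcal F^{-1}+D)\bigr)$, where $\operatorname{ri}(S)$ is the relative interior of $S$, i.e. the interior of $S$ relative to its closed affine hull; 4. there is $y_0\in H_2$ such that for every $x\in H_1$ with $Cx\in\operatorname{rge}(\mathcal F^{-1}+D)$ one has $$\bigl(y_0+\operatorname{rge}(D+D^T)\bigr)\cap(\mathcal F^{-1}+D)^{-1}(Cx)\neq\emptyset .$$ Then the set-valued operator $\mathcal H:=Pf+PB(\mathcal F^{-1}+D)^{-1}C$ on $H_1$, that is, $$\mathcal H(x)=\{Pf(x)+PBy:\ y\in(\mathcal F^{-1}+D)^{-1}(Cx)\},$$ is maximal monotone. -/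

import Mathlib

open scoped Pointwise NNReal InnerProductSpace

namespace Lure

/-- Graph of a set-valued mapping `F : X ⇉ Y`. -/
def graph {X Y : Type*} (F : X → Set Y) : Set (X × Y) :=
  {p | p.2 ∈ F p.1}

/-- Range of a set-valued mapping. -/
def rge {X Y : Type*} (F : X → Set Y) : Set Y :=
  ⋃ x, F x

/-- Inverse of a set-valued mapping: `F⁻¹(y) = {x | y ∈ F(x)}`. -/
def inv {X Y : Type*} (F : X → Set Y) : Y → Set X :=
  fun y => {x | y ∈ F x}

section Hilbert

variable {H : Type*} [NormedAddCommGroup H] [InnerProductSpace ℝ H]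

/-- Monotone set-valued operator. -/
def IsMonotone (F : H → Set H) : Prop :=
  ∀ x y : H, ∀ u ∈ F x, ∀ v ∈ F y, 0 ≤ ⟪u - v, x - y⟫_ℝ

/-- Maximal monotone: monotone, and the graph is not strictly contained in
the graph of another monotone operator. -/
def IsMaximalMonotone (F : H → Set H) : Prop :=
  IsMonotone F ∧ ¬ ∃ G : H → Set H, IsMonotone G ∧ graph F ⊂ graph G

/-- Relative interior of a subset of a Hilbert space: the interior of `S` relative to the
closed affine hull of `S`. -/
def relInterior (S : Set H) : Set H :=
  {x | x ∈ S ∧ ∃ ε > 0, Metric.ball x ε ∩ closure (affineSpan ℝ S : Set H) ⊆ S}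

/-- Semi-coercive bounded operator: `⟨E x, x⟩ ≥ c ‖x‖²` on `rge (E + Eᵀ)` for some `c > 0`. -/
def IsSemiCoercive [CompleteSpace H] (E : H →L[ℝ] H) : Prop :=
  ∃ c > 0, ∀ x ∈ Set.range (E + ContinuousLinearMap.adjoint E), c * ‖x‖ ^ 2 ≤ ⟪E x, x⟫_ℝ

end Hilbert

section System

variable {H₁ H₂ : Type*}
  [NormedAddCommGroup H₁] [InnerProductSpace ℝ H₁] [CompleteSpace H₁]
  [NormedAddCommGroup H₂] [InnerProductSpace ℝ H₂] [CompleteSpace H₂]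

/-- The system `(f, B, C, D)` is `P`-passive. `P.IsPositive` says that `P` is symmetric and
`⟨P x, x⟩ ≥ 0` for all `x`. -/
def IsPassive (P : H₁ →L[ℝ] H₁) (f : H₁ → H₁) (B : H₂ →L[ℝ] H₁) (C : H₁ →L[ℝ] H₂)
    (D : H₂ →L[ℝ] H₂) : Prop :=
  P.IsPositive ∧ ∀ (x₁ x₂ : H₁) (y₁ y₂ : H₂),
    0 ≤ ⟪P (f x₁ - f x₂), x₁ - x₂⟫_ℝ
      + ⟪(P ∘L B - ContinuousLinearMap.adjoint C) (y₁ - y₂), x₁ - x₂⟫_ℝ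
      + ⟪D (y₁ - y₂), y₁ - y₂⟫_ℝ

/-- The set-valued operator `F⁻¹ + D`. -/
def invAdd (F : H₂ → Set H₂) (D : H₂ →L[ℝ] H₂) : H₂ → Set H₂ :=
  fun y => inv F y + {D y}

/-- The operator `P f + P B (F⁻¹ + D)⁻¹ C`. -/
def operatorH (P : H₁ →L[ℝ] H₁) (f : H₁ → H₁) (B : H₂ →L[ℝ] H₁) (C : H₁ →L[ℝ] H₂)
    (D : H₂ →L[ℝ] H₂) (F : H₂ → Set H₂) : H₁ → Set H₁ :=
  fun x => {P (f x)} + (fun y => P (B y)) '' inv (invAdd F D) (C x)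

end System

end Lure

/-! Put `N = PB - Cᵀ` and `Φ = (F⁻¹ + D)⁻¹`. Monotonicity of `F` gives `⟪D δy, δy⟫ ≤ ⟪C δx, δy⟫` for
differences of points of `Φ ∘ C`, so passivity makes the operator monotone. By Minty's criterion,
maximality follows once `1 + t H` is onto for a single `t > 0`.

Split `H = CᵀΦC + (Pf + NΦC)`. The second summand is single-valued and Lipschitz on the domain of
the first. Two values `y, y'` of `Φ` at one point satisfy `⟪D (y - y'), y - y'⟫ ≤ 0`, and passivity
with `f` Lipschitz then forces `N (y - y') = 0` (`IsPassive.comp_sub_adjoint_eq_zero`). So `y` may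
be replaced by a selection in `y₀ + rge (D + Dᵀ)`, which is Lipschitz by semi-coercivity. For small
`t` this perturbation is absorbed by a contraction (`IsMonotone.surjective_add_of_lipschitz`).

What remains is that `1 + t CᵀΦC` is onto (`IsMaximalMonotone.surjective_adjoint_comp`). Regularized
equations are solved by Minty's theorem; the relative interior condition bounds their solutions via
Banach–Steinhaus, and a weak limit solves the original equation. -/

open Filter Topology

namespace Lure

/-! ### Minimization over closed convex epigraphs -/

section Minimization

variable {E : Type*} [NormedAddCommGroup E] [InnerProductSpace ℝ E] [CompleteSpace E]

/-- A closed convex set `K` of pairs `(p, r)` on which `‖p‖² / 2 + r` is nonnegative contains a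
minimizer of this function; the conclusion is the first-order optimality condition. -/
theorem exists_forall_inner_sub_nonneg {K : Set (E × ℝ)} (hne : K.Nonempty) (hcl : IsClosed K)
    (hconv : Convex ℝ K) (hpos : ∀ k ∈ K, 0 ≤ ‖k.1‖ ^ 2 / 2 + k.2) :
    ∃ k ∈ K, ∀ l ∈ K, 0 ≤ ⟪k.1, l.1 - k.1⟫_ℝ + (l.2 - k.2) := by
  set v : E × ℝ → ℝ := fun k => ‖k.1‖ ^ 2 / 2 + k.2 with hv
  set m : ℝ := sInf (v '' K) with hm
  have hbdd : BddBelow (v '' K) := ⟨0, by rintro _ ⟨k, hk, rfl⟩; exact hpos k hk⟩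
  have hle : ∀ k ∈ K, m ≤ v k := fun k hk => csInf_le hbdd ⟨k, hk, rfl⟩
  have hex : ∀ n : ℕ, ∃ k ∈ K, v k < m + 1 / ((n : ℝ) + 1) := by
    intro n
    obtain ⟨_, ⟨k, hk, rfl⟩, h⟩ := exists_lt_of_csInf_lt (hne.image v)
      (show sInf (v '' K) < m + 1 / ((n : ℝ) + 1) by
        have : (0 : ℝ) < 1 / ((n : ℝ) + 1) := by positivity
        linarith)
    exact ⟨k, hk, h⟩
  choose k hkK hk using hex
  have hlim : Tendsto (fun n : ℕ => 1 / ((n : ℝ) + 1)) atTop (𝓝 0) :=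
    tendsto_one_div_add_atTop_nhds_zero_nat
  -- The parallelogram law at the midpoint makes the first components of any minimizing sequence
  -- Cauchy, so no weak compactness is needed.
  have hmid : ∀ a ∈ K, ∀ b ∈ K, ‖a.1 - b.1‖ ^ 2 ≤ 4 * (v a - m) + 4 * (v b - m) := by
    intro a ha b hb
    have h1 := hle _ (hconv ha hb (show (0 : ℝ) ≤ 1 / 2 by norm_num)
      (show (0 : ℝ) ≤ 1 / 2 by norm_num) (by norm_num))
    simp only [hv, Prod.fst_add, Prod.smul_fst, Prod.snd_add, Prod.smul_snd, smul_eq_mul] at h1 ⊢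
    rw [← smul_add, norm_smul] at h1
    have h2 := parallelogram_law_with_norm ℝ a.1 b.1
    norm_num at h1
    nlinarith
  have hcau : CauchySeq (fun n => (k n).1) := by
    rw [Metric.cauchySeq_iff']
    intro ε hε
    obtain ⟨N, hN⟩ := exists_nat_one_div_lt (show 0 < ε ^ 2 / 8 by positivity)
    refine ⟨N, fun n hn => ?_⟩
    have h1 := hmid _ (hkK n) _ (hkK N)
    have h2 : 1 / ((n : ℝ) + 1) ≤ 1 / ((N : ℝ) + 1) := Nat.one_div_le_one_div hn
    rw [dist_eq_norm]
    refine lt_of_pow_lt_pow_left₀ 2 hε.le ?_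
    linarith [hk n, hk N]
  obtain ⟨p, hp⟩ := cauchySeq_tendsto_of_complete hcau
  have hvm : Tendsto (fun n => v (k n)) atTop (𝓝 m) :=
    tendsto_of_tendsto_of_tendsto_of_le_of_le tendsto_const_nhds
      (by simpa using hlim.const_add m) (fun n => hle _ (hkK n)) (fun n => (hk n).le)
  have hr : Tendsto (fun n => (k n).2) atTop (𝓝 (m - ‖p‖ ^ 2 / 2)) := by
    have := hvm.sub ((hp.norm.pow 2).div_const 2)
    simpa [hv] using this
  have hmem : (p, m - ‖p‖ ^ 2 / 2) ∈ K :=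
    hcl.mem_of_tendsto (hp.prodMk_nhds hr) (Eventually.of_forall fun n => hkK n)
  refine ⟨_, hmem, fun l hl => ?_⟩
  set r := m - ‖p‖ ^ 2 / 2 with hrdef
  have hseg : ∀ t : ℝ, 0 < t → t ≤ 1 →
      0 ≤ (⟪p, l.1 - p⟫_ℝ + (l.2 - r)) + t * (‖l.1 - p‖ ^ 2 / 2) := by
    intro t ht ht1
    have h1 := hle _ (hconv hmem hl (sub_nonneg.2 ht1) ht.le (by ring))
    have e : (1 - t) • p + t • l.1 = p + t • (l.1 - p) := by module
    simp only [hv, Prod.fst_add, Prod.smul_fst, Prod.snd_add, Prod.smul_snd, smul_eq_mul, e,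
      norm_add_sq_real, inner_smul_right, norm_smul, mul_pow, Real.norm_eq_abs, sq_abs] at h1
    have : 0 ≤ t * ((⟪p, l.1 - p⟫_ℝ + (l.2 - r)) + t * (‖l.1 - p‖ ^ 2 / 2)) := by
      rw [hrdef] at h1 ⊢; nlinarith
    exact nonneg_of_mul_nonneg_right this ht
  have hT : Tendsto (fun t : ℝ => (⟪p, l.1 - p⟫_ℝ + (l.2 - r)) + t * (‖l.1 - p‖ ^ 2 / 2))
      (𝓝[>] 0) (𝓝 (⟪p, l.1 - p⟫_ℝ + (l.2 - r))) := by
    have : Continuous fun t : ℝ => (⟪p, l.1 - p⟫_ℝ + (l.2 - r)) + t * (‖l.1 - p‖ ^ 2 / 2) := by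
      fun_prop
    simpa using (this.tendsto 0).mono_left nhdsWithin_le_nhds
  refine ge_of_tendsto hT ?_
  filter_upwards [Ioc_mem_nhdsGT (zero_lt_one' ℝ)] with t ht using hseg t ht.1 ht.2

end Minimization

/-! ### Minty's theorem -/

section Maximal

variable {H : Type*} [NormedAddCommGroup H] [InnerProductSpace ℝ H]

theorem IsMaximalMonotone.mem {A : H → Set H} (hA : IsMaximalMonotone A) {x u : H}
    (h : ∀ y, ∀ v ∈ A y, 0 ≤ ⟪u - v, x - y⟫_ℝ) : u ∈ A x := by
  by_contra hu
  refine hA.2 ⟨fun z => A z ∪ {w | z = x ∧ w = u}, ?_, fun p hp => Or.inl hp,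
    fun hsub => hu (hsub (show (x, u) ∈ _ from Or.inr ⟨rfl, rfl⟩))⟩
  rintro y z v (hv | ⟨rfl, rfl⟩) w (hw | ⟨rfl, rfl⟩)
  · exact hA.1 _ _ _ hv _ hw
  · have := h y v hv
    rwa [← neg_sub v, ← neg_sub y, inner_neg_neg] at this
  · exact h z w hw
  · simp

theorem IsMaximalMonotone.exists_mem {A : H → Set H} (hA : IsMaximalMonotone A) :
    ∃ x u, u ∈ A x := by
  by_contra! h
  exact h 0 0 (hA.mem fun y v hv => absurd hv (h y v))

/-- If `(y, v)` lies in a monotone extension, `y + t v` is also `x + t u` with `u ∈ A x`; then `x -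
y = -t (u - v)`, and monotonicity forces the two points to coincide. -/
theorem isMaximalMonotone_of_surjective {A : H → Set H} (hA : IsMonotone A) {t : ℝ} (ht : 0 < t)
    (h : ∀ w, ∃ x, ∃ u ∈ A x, x + t • u = w) : IsMaximalMonotone A := by
  refine ⟨hA, ?_⟩
  rintro ⟨G, hG, hsub, hnot⟩
  refine hnot ?_
  rintro ⟨y, v⟩ hv
  obtain ⟨x, u, hu, hxu⟩ := h (y + t • v)
  have h1 := hG x y u (hsub (show (x, u) ∈ graph A from hu)) v hv
  have e : x - y = - t • (u - v) := by
    rw [eq_comm, ← sub_eq_zero]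
    rw [← sub_eq_zero] at hxu
    rw [← neg_eq_zero, ← hxu]
    module
  rw [e, inner_smul_right, real_inner_self_eq_norm_sq] at h1
  have h2 : ‖u - v‖ ^ 2 ≤ 0 := by nlinarith [sq_nonneg ‖u - v‖]
  have h3 : u = v := by
    rw [← sub_eq_zero, ← norm_eq_zero]
    exact pow_eq_zero_iff two_ne_zero |>.1 (le_antisymm h2 (sq_nonneg _))
  subst h3
  have h4 : x = y := by simpa using hxu
  subst h4
  exact hu

theorem IsMonotone.inv {A : H → Set H} (hA : IsMonotone A) : IsMonotone (inv A) := by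
  intro x y u hu v hv
  rw [real_inner_comm]
  exact hA u v x hu y hv

theorem IsMaximalMonotone.inv {A : H → Set H} (hA : IsMaximalMonotone A) :
    IsMaximalMonotone (inv A) := by
  refine ⟨hA.1.inv, ?_⟩
  rintro ⟨G, hG, hsub, hnot⟩
  refine hnot ?_
  rintro ⟨y, v⟩ hv
  refine hA.mem fun z w hw => ?_
  rw [real_inner_comm]
  exact hG y w v hv z (hsub (show (w, z) ∈ graph (Lure.inv A) from hw))

variable [CompleteSpace H]

/-- Minty's theorem at the origin, by minimizing the sum of the Fitzpatrick function and
`‖·‖² / 2`. -/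
theorem IsMaximalMonotone.exists_neg_mem {A : H → Set H} (hA : IsMaximalMonotone A) :
    ∃ x, -x ∈ A x := by
  -- The epigraph of the Fitzpatrick function of `A`. The `L²` product norm makes `‖(x, u)‖² = ‖x‖²
  -- + ‖u‖²`.
  set K : Set (WithLp 2 (H × H) × ℝ) := {k | ∀ a, ∀ b ∈ A a,
    ⟪k.1.fst, b⟫_ℝ + ⟪a, k.1.snd⟫_ℝ - ⟪a, b⟫_ℝ ≤ k.2} with hK
  have hgraph : ∀ a, ∀ b ∈ A a, (WithLp.toLp 2 (a, b), ⟪a, b⟫_ℝ) ∈ K := by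
    intro a b hb a' b' hb'
    have := hA.1 a a' b hb b' hb'
    simp only [inner_sub_left, inner_sub_right] at this
    simp only [WithLp.toLp_fst, WithLp.toLp_snd]
    rw [real_inner_comm a b, real_inner_comm a' b, real_inner_comm a b', real_inner_comm a' b']
      at *
    linarith
  -- A point violating this bound would be monotonically related to the graph, hence on it, where
  -- the bound holds.
  have hFitz : ∀ k ∈ K, ⟪k.1.fst, k.1.snd⟫_ℝ ≤ k.2 := by
    intro k hk
    by_contra! hlt
    have hmem : k.1.snd ∈ A k.1.fst := hA.mem fun a b hb => by
      have := hk a b hb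
      simp only [inner_sub_left, inner_sub_right]
      rw [real_inner_comm k.1.fst k.1.snd, real_inner_comm k.1.fst b, real_inner_comm a k.1.snd,
        real_inner_comm a b]
      linarith
    have := hk _ _ hmem
    linarith
  have hcl : IsClosed K := by
    simp only [hK, Set.ofPred_forall]
    refine isClosed_iInter fun a => isClosed_iInter fun b => isClosed_iInter fun _ =>
      isClosed_le ?_ continuous_snd
    fun_prop
  have hconv : Convex ℝ K := by
    intro k hk l hl s t hs ht hst a b hb
    have h1 := mul_le_mul_of_nonneg_left (hk a b hb) hs
    have h2 := mul_le_mul_of_nonneg_left (hl a b hb) ht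
    simp only [Prod.fst_add, Prod.smul_fst, Prod.snd_add, Prod.smul_snd, WithLp.add_fst,
      WithLp.smul_fst, WithLp.add_snd, WithLp.smul_snd, inner_add_left, inner_add_right,
      inner_smul_left, inner_smul_right, smul_eq_mul, RCLike.conj_to_real]
    have : ⟪a, b⟫_ℝ = (s + t) * ⟪a, b⟫_ℝ := by rw [hst, one_mul]
    linarith
  obtain ⟨a₀, b₀, h₀⟩ := hA.exists_mem
  obtain ⟨k, hk, hopt⟩ := exists_forall_inner_sub_nonneg ⟨_, hgraph a₀ b₀ h₀⟩ hcl hconv (by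
    intro k hk
    have h1 := hFitz k hk
    have h2 := norm_add_sq_real k.1.fst k.1.snd
    have h3 := WithLp.prod_norm_sq_eq_of_L2 k.1
    nlinarith [sq_nonneg ‖k.1.fst + k.1.snd‖])
  set x := k.1.fst with hx
  set u := k.1.snd with hu
  have key : ∀ a, ∀ b ∈ A a, ‖x + u‖ ^ 2 ≤ ⟪-x - b, -u - a⟫_ℝ := by
    intro a b hb
    have h1 := hopt _ (hgraph a b hb)
    have h2 := hFitz k hk
    rw [inner_sub_right, real_inner_self_eq_norm_sq, WithLp.prod_norm_sq_eq_of_L2,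
      WithLp.prod_inner_apply] at h1
    change 0 ≤ ⟪x, a⟫_ℝ + ⟪u, b⟫_ℝ - (‖x‖ ^ 2 + ‖u‖ ^ 2) + (⟪a, b⟫_ℝ - k.2) at h1
    rw [norm_add_sq_real]
    simp only [inner_sub_left, inner_sub_right, inner_neg_left, inner_neg_right]
    rw [real_inner_comm u b, real_inner_comm a b]
    linarith
  have hmem : -x ∈ A (-u) := hA.mem fun a b hb => (sq_nonneg _).trans (key a b hb)
  have h0 : ‖x + u‖ ^ 2 ≤ 0 := by simpa using key _ _ hmem
  have h1 : x + u = 0 := by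
    rw [← norm_eq_zero]
    exact pow_eq_zero_iff two_ne_zero |>.1 (le_antisymm h0 (sq_nonneg _))
  rw [← eq_neg_iff_add_eq_zero] at h1
  exact ⟨x, by rwa [← h1] at hmem⟩

/-- Minty's theorem. -/
theorem IsMaximalMonotone.surjective {A : H → Set H} (hA : IsMaximalMonotone A) {t : ℝ}
    (ht : 0 < t) (w : H) : ∃ x, ∃ u ∈ A x, x + t • u = w := by
  -- This operator is `t A - w`; a point `x` with `-x` in its value solves `x + t u = w`.
  have hmax : IsMaximalMonotone fun x => {v | t⁻¹ • (v + w) ∈ A x} := by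
    have hmono : IsMonotone fun x => {v | t⁻¹ • (v + w) ∈ A x} := by
      intro x y u hu v hv
      have := hA.1 x y _ hu _ hv
      rw [← smul_sub, add_sub_add_right_eq_sub, inner_smul_left] at this
      exact nonneg_of_mul_nonneg_right this (by simpa using ht)
    refine ⟨hmono, ?_⟩
    rintro ⟨G, hG, hsub, hnot⟩
    refine hnot ?_
    rintro ⟨y, v⟩ hv
    refine hA.mem fun z b hb => ?_
    have h1 := hG y z v hv (t • b - w)
      (hsub (show (z, t • b - w) ∈ graph _ from by
        change t⁻¹ • (t • b - w + w) ∈ A z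
        rwa [sub_add_cancel, smul_smul, inv_mul_cancel₀ ht.ne', one_smul]))
    have e : t⁻¹ • (v + w) - b = t⁻¹ • (v - (t • b - w)) := by
      rw [sub_sub_eq_add_sub, smul_sub, smul_smul, inv_mul_cancel₀ ht.ne', one_smul]
    rw [e, inner_smul_left]
    exact mul_nonneg (by simpa using ht.le) h1
  obtain ⟨x, hx⟩ := hmax.exists_neg_mem
  exact ⟨x, _, hx, by rw [smul_smul, mul_inv_cancel₀ ht.ne']; simp⟩

end Maximal
-- Lipschitz and coercive perturbations
section Sum

variable {H : Type*} [NormedAddCommGroup H] [InnerProductSpace ℝ H]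

theorem mem_inv_invAdd {F : H → Set H} {D : H →L[ℝ] H} {y z : H} :
    y ∈ inv (invAdd F D) z ↔ y ∈ F (z - D y) := by
  simp only [inv, invAdd, Set.mem_ofPred_eq, Set.add_singleton, Set.mem_image]
  constructor
  · rintro ⟨a, ha, rfl⟩; simpa using ha
  · intro h; exact ⟨_, h, by simp⟩

theorem inner_le_of_mem_inv_invAdd {F : H → Set H} {D : H →L[ℝ] H}
    (hF : IsMonotone F) {y₁ y₂ z₁ z₂ : H}
    (h₁ : y₁ ∈ inv (invAdd F D) z₁) (h₂ : y₂ ∈ inv (invAdd F D) z₂) :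
    ⟪D (y₁ - y₂), y₁ - y₂⟫_ℝ ≤ ⟪z₁ - z₂, y₁ - y₂⟫_ℝ := by
  have h := hF _ _ _ (mem_inv_invAdd.1 h₁) _ (mem_inv_invAdd.1 h₂)
  rw [real_inner_comm, sub_sub_sub_comm, ← map_sub, inner_sub_left] at h
  linarith

theorem norm_resolvent_sub_le {A : H → Set H} (hA : IsMonotone A) {t : ℝ} (ht : 0 ≤ t)
    {x y u v : H} (hu : u ∈ A x) (hv : v ∈ A y) : ‖x - y‖ ≤ ‖(x + t • u) - (y + t • v)‖ := by
  have h1 := hA x y u hu v hv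
  have e : (x + t • u) - (y + t • v) = (x - y) + t • (u - v) := by module
  refine le_of_sq_le_sq ?_ (norm_nonneg _)
  rw [e, norm_add_sq_real, inner_smul_right, real_inner_comm]
  nlinarith [mul_nonneg ht h1, sq_nonneg ‖t • (u - v)‖]

variable [CompleteSpace H]

/-- If `A` is monotone with everywhere defined resolvent and `g` is `K`-Lipschitz on the domain
of `A`, then `1 + t (A + g)` is surjective when `t K < 1`. -/
theorem IsMonotone.surjective_add_of_lipschitz {A : H → Set H} (hA : IsMonotone A)
    {t K : ℝ} (ht : 0 < t) (hAt : ∀ w, ∃ x, ∃ u ∈ A x, x + t • u = w)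
    {g : H → H} (hg : ∀ x y, (A x).Nonempty → (A y).Nonempty → ‖g x - g y‖ ≤ K * ‖x - y‖)
    (htK : t * K < 1) (hK : 0 ≤ K) (w : H) : ∃ x, ∃ u ∈ A x, x + t • (u + g x) = w := by
  choose J U hU hJ using hAt
  have hlip : LipschitzWith (NNReal.mk (t * K) (by positivity)) fun z => w - t • g (J z) := by
    refine LipschitzWith.of_dist_le_mul fun z z' => ?_
    have h1 := norm_resolvent_sub_le hA ht.le (hU z) (hU z')
    rw [hJ, hJ] at h1
    rw [dist_eq_norm, dist_eq_norm, sub_sub_sub_cancel_left, ← smul_sub, norm_smul,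
      Real.norm_of_nonneg ht.le, norm_sub_rev, NNReal.coe_mk, mul_assoc]
    refine mul_le_mul_of_nonneg_left ?_ ht.le
    exact (hg _ _ ⟨_, hU z⟩ ⟨_, hU z'⟩).trans (mul_le_mul_of_nonneg_left h1 hK)
  have hc : ContractingWith (NNReal.mk (t * K) (by positivity)) fun z => w - t • g (J z) :=
    ⟨by exact_mod_cast htK, hlip⟩
  have hfix := hc.fixedPoint_isFixedPt
  set z := hc.fixedPoint with hz
  have hfix' : w - t • g (J z) = z := hfix
  refine ⟨J z, U z, hU z, ?_⟩
  rw [smul_add, ← add_assoc, hJ, ← eq_sub_iff_add_eq, hfix']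

/-- The sum of a maximal monotone operator and a strongly monotone bounded linear operator is
surjective. -/
theorem IsMaximalMonotone.surjective_add_of_coercive {A : H → Set H} (hA : IsMaximalMonotone A)
    {E : H →L[ℝ] H} {c : ℝ} (hc : 0 < c) (hE : ∀ x, c * ‖x‖ ^ 2 ≤ ⟪E x, x⟫_ℝ) (w : H) :
    ∃ x, ∃ u ∈ A x, u + E x = w := by
  -- This choice gives `‖1 - t E‖² ≤ 1 - 2tc + t²‖E‖² ≤ 1 - tc`; the term `c ^ 2` keeps the
  -- denominator positive and `t c ≤ 1`.
  set t : ℝ := c / (‖E‖ ^ 2 + c ^ 2) with ht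
  have hden : 0 < ‖E‖ ^ 2 + c ^ 2 := by positivity
  have htpos : 0 < t := by positivity
  have htm : t * (‖E‖ ^ 2 + c ^ 2) = c := by rw [ht]; field_simp
  have hq : 0 ≤ 1 - t * c := by
    have : t * c * (‖E‖ ^ 2 + c ^ 2) ≤ 1 * (‖E‖ ^ 2 + c ^ 2) := by nlinarith [sq_nonneg ‖E‖]
    linarith [le_of_mul_le_mul_right this hden]
  set k : ℝ := Real.sqrt (1 - t * c) with hk
  have hk0 : 0 ≤ k := Real.sqrt_nonneg _
  have hksq : k ^ 2 = 1 - t * c := Real.sq_sqrt hq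
  have hk1 : k < 1 := by nlinarith [mul_pos htpos hc]
  have hcontr : ∀ x, ‖x - t • E x‖ ≤ k * ‖x‖ := by
    intro x
    refine le_of_sq_le_sq ?_ (by positivity)
    rw [norm_sub_sq_real, inner_smul_right, real_inner_comm, norm_smul, mul_pow, mul_pow, hksq,
      Real.norm_of_nonneg htpos.le]
    have h1 : ‖E x‖ ^ 2 ≤ ‖E‖ ^ 2 * ‖x‖ ^ 2 := by
      rw [← mul_pow]
      exact pow_le_pow_left₀ (norm_nonneg _) (E.le_opNorm x) 2
    have h2 := mul_le_mul_of_nonneg_left (hE x) htpos.le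
    have h3 := mul_le_mul_of_nonneg_left h1 (sq_nonneg t)
    have h4 : t ^ 2 * (‖E‖ ^ 2 * ‖x‖ ^ 2) ≤ t * c * ‖x‖ ^ 2 := by
      have : t ^ 2 * ‖E‖ ^ 2 ≤ t * c := by nlinarith [sq_nonneg (t * c)]
      nlinarith [mul_le_mul_of_nonneg_right this (sq_nonneg ‖x‖)]
    nlinarith
  -- With this `g`, the equation `x + t (u + g x) = 0` reduces to `u + E x = w`, and `t g` is `-(1 -
  -- t E)` up to a constant.
  obtain ⟨x, u, hu, hx⟩ := hA.1.surjective_add_of_lipschitz (t := t) (K := k / t)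
    (g := fun x => E x - w - t⁻¹ • x) htpos (hA.surjective htpos) (fun x y _ _ => by
      have e : (E x - w - t⁻¹ • x) - (E y - w - t⁻¹ • y) = - (t⁻¹ • ((x - y) - t • E (x - y))) := by
        rw [smul_sub, smul_smul, inv_mul_cancel₀ htpos.ne', map_sub]; module
      rw [e, norm_neg, norm_smul, norm_inv, Real.norm_of_nonneg htpos.le, div_eq_inv_mul, mul_assoc]
      exact mul_le_mul_of_nonneg_left (hcontr _) (by positivity))
    (by rw [mul_div_cancel₀ _ htpos.ne']; exact hk1) (by positivity) 0
  refine ⟨x, u, hu, ?_⟩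
  rw [smul_add, smul_sub, smul_smul, mul_inv_cancel₀ htpos.ne', one_smul] at hx
  have h : t • (u + E x - w) = 0 := by rw [← hx]; module
  rw [smul_eq_zero_iff_right htpos.ne', sub_eq_zero] at h
  exact h

theorem IsMaximalMonotone.invAdd {F : H → Set H} (hF : IsMaximalMonotone F) {D : H →L[ℝ] H}
    (hD : ∀ y, 0 ≤ ⟪D y, y⟫_ℝ) : IsMaximalMonotone (invAdd F D) := by
  refine isMaximalMonotone_of_surjective ?_ one_pos fun w => ?_
  · intro x y u hu v hv
    have h1 := hF.1.inv x y _ (mem_inv_invAdd.1 hu) _ (mem_inv_invAdd.1 hv)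
    have h2 := hD (x - y)
    rw [map_sub] at h2
    have e : u - v = (u - D x - (v - D y)) + (D x - D y) := by abel
    rw [e, inner_add_left]
    exact add_nonneg h1 h2
  · obtain ⟨x, u, hu, hx⟩ := hF.inv.surjective_add_of_coercive (E := D + .id ℝ H) one_pos
      (fun x => by
        simp only [add_apply, ContinuousLinearMap.id_apply, inner_add_left,
          real_inner_self_eq_norm_sq]
        linarith [hD x]) w
    refine ⟨x, u + D x, Set.add_mem_add hu rfl, ?_⟩
    rw [← hx]
    simp only [add_apply, ContinuousLinearMap.id_apply]
    module

end Sum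
-- Banach–Alaoglu along an ultrafilter: a weak limit of a bounded sequence without extracting
-- subsequences.
theorem exists_tendsto_inner_hyperfilter {H : Type*} [NormedAddCommGroup H]
    [InnerProductSpace ℝ H] [CompleteSpace H] {y : ℕ → H} {R : ℝ} (hy : ∀ n, ‖y n‖ ≤ R) :
    ∃ a, ∀ z, Tendsto (fun n => ⟪y n, z⟫_ℝ) (hyperfilter ℕ) (𝓝 ⟪a, z⟫_ℝ) := by
  set ψ : ℕ → WeakDual ℝ H := fun n =>
    StrongDual.toWeakDual (InnerProductSpace.toDual ℝ H (y n)) with hψ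
  have hK := WeakDual.isCompact_closedBall (𝕜 := ℝ) (E := H) 0 R
  obtain ⟨l, -, hl⟩ := hK.ultrafilter_le_nhds ((hyperfilter ℕ).map ψ) (by
    rw [le_principal_iff]
    refine Filter.mem_map.2 (univ_mem' fun n => ?_)
    simpa [hψ] using hy n)
  refine ⟨(InnerProductSpace.toDual ℝ H).symm (WeakDual.toStrongDual l), fun z => ?_⟩
  have h1 : Tendsto (fun n => ψ n z) (hyperfilter ℕ) (𝓝 (l z)) :=
    ((WeakDual.eval_continuous z).tendsto l).comp hl
  rw [InnerProductSpace.toDual_symm_apply]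
  exact h1

theorem coe_affineSpan_of_zero_mem {H : Type*} [NormedAddCommGroup H] [InnerProductSpace ℝ H]
    {S : Set H} (h : (0 : H) ∈ S) : (affineSpan ℝ S : Set H) = Submodule.span ℝ S := by
  rw [← affineSpan_insert_zero, Set.insert_eq_of_mem h]

/-! ### Composition with a linear map under the constraint qualification -/

section Composition

variable {H₁ H₂ : Type*}
  [NormedAddCommGroup H₁] [InnerProductSpace ℝ H₁] [CompleteSpace H₁]
  [NormedAddCommGroup H₂] [InnerProductSpace ℝ H₂] [CompleteSpace H₂]

local postfix:max "†" => ContinuousLinearMap.adjoint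

/-- Eliminating `x = w - t Cᵀ y` leaves `C w ∈ G y + μ y + t C Cᵀ y`, where the linear part is
strongly monotone thanks to `μ`. -/
theorem IsMaximalMonotone.exists_regularized {G : H₂ → Set H₂} (hG : IsMaximalMonotone G)
    (C : H₁ →L[ℝ] H₂) {t μ : ℝ} (ht : 0 ≤ t) (hμ : 0 < μ) (w : H₁) :
    ∃ x y, C x - μ • y ∈ G y ∧ x + t • C† y = w := by
  obtain ⟨y, u, hu, hy⟩ := hG.surjective_add_of_coercive (c := μ)
    (E := μ • .id ℝ H₂ + t • (C ∘L C†)) hμ (fun y => by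
      have h : 0 ≤ ⟪C (C† y), y⟫_ℝ := by
        rw [← ContinuousLinearMap.adjoint_inner_right]
        exact real_inner_self_nonneg
      simp only [add_apply, smul_apply, ContinuousLinearMap.id_apply,
        ContinuousLinearMap.comp_apply, inner_add_left, inner_smul_left, RCLike.conj_to_real,
        real_inner_self_eq_norm_sq]
      linarith [mul_nonneg ht h]) (C w)
  refine ⟨w - t • C† y, y, ?_, by simp⟩
  convert hu using 1
  simp only [add_apply, smul_apply, ContinuousLinearMap.id_apply,
    ContinuousLinearMap.comp_apply] at hy
  rw [map_sub, ← hy, map_smul]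
  abel

/-- One-sided bound on `y` tested against `C a - d`. The right side is free of `μ` and `y`, so it is
uniform along the regularization. -/
theorem IsMonotone.neg_inner_le {G : H₂ → Set H₂} (hG : IsMonotone G) {C : H₁ →L[ℝ] H₂}
    {t μ : ℝ} (ht : 0 < t) (hμ : 0 < μ) (hμ1 : μ ≤ 1) {x a w : H₁} {y d e : H₂}
    (hy : C x - μ • y ∈ G y) (hx : x + t • C† y = w) (hd : d ∈ G e) :
    -⟪C a - d, y⟫_ℝ ≤ t⁻¹ * ⟪x - a, w - x⟫_ℝ + ‖e‖ ^ 2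
      + (‖C‖ * ‖x - a‖ + ‖C a - d‖) * ‖e‖ := by
  have h1 := hG y e _ hy d hd
  have h2 : ⟪C (x - a), y⟫_ℝ = t⁻¹ * ⟪x - a, w - x⟫_ℝ := by
    rw [← hx, add_sub_cancel_left, inner_smul_right, ← mul_assoc, inv_mul_cancel₀ ht.ne', one_mul,
      ContinuousLinearMap.adjoint_inner_right]
  have h3 : -⟪C (x - a) + (C a - d), e⟫_ℝ ≤ (‖C‖ * ‖x - a‖ + ‖C a - d‖) * ‖e‖ := by
    refine (neg_le_abs _).trans ((abs_real_inner_le_norm _ _).trans ?_)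
    gcongr
    exact (norm_add_le _ _).trans (by gcongr; exact C.le_opNorm _)
  have h4 : μ * ⟪y, e⟫_ℝ - μ * ‖y‖ ^ 2 ≤ ‖e‖ ^ 2 := by
    have h5 := norm_sub_sq_real y e
    have : ⟪y, e⟫_ℝ - ‖y‖ ^ 2 ≤ ‖e‖ ^ 2 := by
      nlinarith [sq_nonneg ‖y - e‖, sq_nonneg ‖y‖, sq_nonneg ‖e‖]
    nlinarith [mul_le_mul_of_nonneg_left this hμ.le, sq_nonneg ‖e‖]
  have e1 : C x - μ • y - d = C (x - a) + (C a - d) - μ • y := by rw [map_sub]; abel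
  rw [e1, inner_sub_right, inner_sub_left _ _ y, inner_sub_left _ _ e, inner_add_left _ _ y, h2,
    inner_smul_left, inner_smul_left, real_inner_self_eq_norm_sq] at h1
  simp only [RCLike.conj_to_real] at h1
  linarith

/-- Under the constraint qualification, `1 + t Cᵀ G⁻¹ C` is surjective. -/
theorem IsMaximalMonotone.surjective_adjoint_comp {G : H₂ → Set H₂} (hG : IsMaximalMonotone G)
    {C : H₁ →L[ℝ] H₂} (hri : (0 : H₂) ∈ relInterior (Set.range C - rge G))
    {t : ℝ} (ht : 0 < t) (w : H₁) : ∃ x, ∃ y ∈ Lure.inv G (C x), x + t • C† y = w := by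
  obtain ⟨h0, ε, hε, hball⟩ := hri
  set S := Set.range C - rge G with hS
  rw [coe_affineSpan_of_zero_mem h0, ← Submodule.topologicalClosure_coe] at hball
  set M := (Submodule.span ℝ S).topologicalClosure with hM
  have hSM : ∀ s ∈ S, s ∈ M := fun s hs =>
    Submodule.le_topologicalClosure _ (Submodule.subset_span hs)
  set μ : ℕ → ℝ := fun n => 1 / ((n : ℝ) + 1) with hμdef
  have hμ0 : ∀ n, 0 < μ n := fun n => Nat.one_div_pos_of_nat
  have hμ1 : ∀ n, μ n ≤ 1 := fun n => by
    simpa [hμdef] using Nat.one_div_le_one_div (α := ℝ) (Nat.zero_le n)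
  have hμlim : Tendsto μ atTop (𝓝 0) := tendsto_one_div_add_atTop_nhds_zero_nat
  choose x y hy hx using fun n => hG.exists_regularized C ht.le (hμ0 n) w
  have hrge : ∀ n, C (x n) - μ n • y n ∈ rge G := fun n => Set.mem_iUnion.2 ⟨_, hy n⟩
  have hyM : ∀ n, y n ∈ M := by
    intro n
    have h1 : μ n • y n ∈ M := hSM _ ⟨C (x n), ⟨_, rfl⟩, _, hrge n, by simp⟩
    exact (M.smul_mem_iff (hμ0 n).ne').1 h1
  have hest : ∀ s ∈ S, ∃ (a : H₁) (e : H₂), ∀ n, -⟪s, y n⟫_ℝ ≤ t⁻¹ * ⟪x n - a, w - x n⟫_ℝ + ‖e‖ ^ 2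
      + (‖C‖ * ‖x n - a‖ + ‖s‖) * ‖e‖ := by
    rintro _ ⟨_, ⟨a, rfl⟩, d, hd, rfl⟩
    obtain ⟨e, he⟩ := Set.mem_iUnion.1 hd
    exact ⟨a, e, fun n => hG.1.neg_inner_le ht (hμ0 n) (hμ1 n) (hy n) (hx n) he⟩
  -- Testing with `s = 0` removes `y n` and leaves a quadratic inequality in `‖x n - a‖`.
  obtain ⟨R, hR⟩ : ∃ R, ∀ n, ‖x n‖ ≤ R := by
    obtain ⟨a, e, h⟩ := hest 0 h0
    set q := t * (‖C‖ * ‖e‖) + ‖w - a‖ with hq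
    refine ⟨‖a‖ + (q + t * ‖e‖ ^ 2 + 1), fun n => ?_⟩
    have h1 := h n
    set ξ := x n - a with hξ
    have e1 : w - x n = (w - a) - ξ := by rw [hξ]; abel
    rw [inner_zero_left, neg_zero, norm_zero, add_zero, e1, inner_sub_right,
      real_inner_self_eq_norm_sq] at h1
    have h2 := real_inner_le_norm ξ (w - a)
    have h3 : ‖ξ‖ ^ 2 ≤ q * ‖ξ‖ + t * ‖e‖ ^ 2 := by
      have := mul_nonneg ht.le h1
      rw [mul_add, mul_add, ← mul_assoc, mul_inv_cancel₀ ht.ne', one_mul] at this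
      rw [hq]; linarith
    have hq0 : 0 ≤ q := by positivity
    have h4 : ‖ξ‖ ≤ q + t * ‖e‖ ^ 2 + 1 := by
      by_contra! hlt
      have : 0 ≤ t * ‖e‖ ^ 2 := by positivity
      nlinarith
    have h5 : x n = a + ξ := by rw [hξ]; abel
    rw [h5]
    exact (norm_add_le _ _).trans (by gcongr)
  have hSbdd : ∀ s ∈ S, ∃ K, ∀ n, -⟪s, y n⟫_ℝ ≤ K := by
    intro s hs
    obtain ⟨a, e, h⟩ := hest s hs
    refine ⟨t⁻¹ * ((R + ‖a‖) * (‖w‖ + R)) + ‖e‖ ^ 2 + (‖C‖ * (R + ‖a‖) + ‖s‖) * ‖e‖,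
      fun n => (h n).trans ?_⟩
    have h1 : ‖x n - a‖ ≤ R + ‖a‖ := (norm_sub_le _ _).trans (by gcongr; exact hR n)
    have h2 : ‖w - x n‖ ≤ ‖w‖ + R := (norm_sub_le _ _).trans (by gcongr; exact hR n)
    have h3 : ⟪x n - a, w - x n⟫_ℝ ≤ (R + ‖a‖) * (‖w‖ + R) :=
      (real_inner_le_norm _ _).trans
        (mul_le_mul h1 h2 (norm_nonneg _) ((norm_nonneg _).trans h1))
    gcongr
  -- Since `y n ∈ M`, only the projection of `z` to `M` matters, and a small positive multiple of it
  -- lies in `S`.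
  have hbdd : ∀ z, ∃ K, ∀ n, -⟪z, y n⟫_ℝ ≤ K := by
    intro z
    set p := M.starProjection z with hp
    have hpM : p ∈ M := Submodule.starProjection_apply_mem _ _
    have hzp : ∀ n, ⟪z, y n⟫_ℝ = ⟪p, y n⟫_ℝ := fun n => by
      rw [hp, Submodule.inner_starProjection_left_eq_right,
        Submodule.starProjection_eq_self_iff.2 (hyM n)]
    set r : ℝ := ε / (‖p‖ + 1) with hr
    have hr0 : 0 < r := by positivity
    obtain ⟨K, hK⟩ := hSbdd (r • p) (hball ⟨by
      rw [mem_ball_zero_iff, norm_smul, Real.norm_of_nonneg hr0.le, hr, div_mul_eq_mul_div,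
        div_lt_iff₀ (by positivity)]
      nlinarith, M.smul_mem r hpM⟩)
    refine ⟨r⁻¹ * K, fun n => ?_⟩
    have h1 := mul_le_mul_of_nonneg_left (hK n) (inv_nonneg.2 hr0.le)
    rwa [inner_smul_left, RCLike.conj_to_real, ← mul_neg, ← mul_assoc, inv_mul_cancel₀ hr0.ne',
      one_mul, ← hzp] at h1
  obtain ⟨Y, hY⟩ : ∃ Y, ∀ n, ‖y n‖ ≤ Y := by
    obtain ⟨Y, hY⟩ := banach_steinhaus (g := fun n => innerSL ℝ (y n)) fun z => by
      obtain ⟨K, hK⟩ := hbdd z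
      obtain ⟨K', hK'⟩ := hbdd (-z)
      refine ⟨max K K', fun n => ?_⟩
      have h2 := hK' n
      rw [inner_neg_left, neg_neg] at h2
      rw [innerSL_apply_apply, real_inner_comm, Real.norm_eq_abs, abs_le']
      exact ⟨h2.trans (le_max_right _ _), (hK n).trans (le_max_left _ _)⟩
    exact ⟨Y, fun n => by simpa using hY n⟩
  have hY0 : 0 ≤ Y := (norm_nonneg _).trans (hY 0)
  -- Monotonicity of `G` at two regularized solutions: strong convergence of `x n` comes from
  -- boundedness of `y n` alone.
  have hdiff : ∀ n m, ‖x n - x m‖ ^ 2 ≤ 2 * t * Y ^ 2 * (μ n + μ m) := by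
    intro n m
    have h1 := hG.1 _ _ _ (hy n) _ (hy m)
    have e1 : t • C† (y n - y m) = -(x n - x m) := by
      have h2 := (hx n).trans (hx m).symm
      rw [← sub_eq_zero] at h2 ⊢
      rw [map_sub, ← h2]
      module
    have e2 : t * ⟪C (x n - x m), y n - y m⟫_ℝ = -‖x n - x m‖ ^ 2 := by
      rw [← ContinuousLinearMap.adjoint_inner_right, ← inner_smul_right, e1, inner_neg_right,
        real_inner_self_eq_norm_sq]
    have e3 : C (x n) - μ n • y n - (C (x m) - μ m • y m)
        = C (x n - x m) - (μ n • y n - μ m • y m) := by rw [map_sub]; abel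
    rw [e3, inner_sub_left] at h1
    have h3 : ‖μ n • y n - μ m • y m‖ ≤ (μ n + μ m) * Y := by
      refine (norm_sub_le _ _).trans ?_
      rw [norm_smul, norm_smul, Real.norm_of_nonneg (hμ0 n).le, Real.norm_of_nonneg (hμ0 m).le,
        add_mul]
      exact add_le_add (mul_le_mul_of_nonneg_left (hY n) (hμ0 n).le)
        (mul_le_mul_of_nonneg_left (hY m) (hμ0 m).le)
    have h4 : ‖y n - y m‖ ≤ 2 * Y := (norm_sub_le _ _).trans (by linarith [hY n, hY m])
    have h5 : -⟪μ n • y n - μ m • y m, y n - y m⟫_ℝ ≤ (μ n + μ m) * Y * (2 * Y) :=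
      ((neg_le_abs _).trans (abs_real_inner_le_norm _ _)).trans
        (mul_le_mul h3 h4 (norm_nonneg _) ((norm_nonneg _).trans h3))
    nlinarith [mul_le_mul_of_nonneg_left h5 ht.le, mul_nonneg ht.le h1]
  have hcau : CauchySeq x := by
    rw [Metric.cauchySeq_iff']
    intro δ hδ
    have hlim : Tendsto (fun n => 4 * t * Y ^ 2 * μ n) atTop (𝓝 0) := by
      simpa using hμlim.const_mul (4 * t * Y ^ 2)
    obtain ⟨N, hN⟩ := (hlim.eventually_lt_const (show 0 < δ ^ 2 by positivity)).exists
    refine ⟨N, fun n hn => ?_⟩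
    have h1 : μ n ≤ μ N := Nat.one_div_le_one_div hn
    have h2 : 0 ≤ 2 * t * Y ^ 2 := by positivity
    rw [dist_eq_norm]
    refine lt_of_pow_lt_pow_left₀ 2 hδ.le ?_
    nlinarith [hdiff n N, mul_le_mul_of_nonneg_left h1 h2]
  obtain ⟨a, ha⟩ := cauchySeq_tendsto_of_complete hcau
  obtain ⟨b, hb⟩ := exists_tendsto_inner_hyperfilter hY
  have hle : (hyperfilter ℕ : Filter ℕ) ≤ atTop := Nat.hyperfilter_le_atTop
  have hu : Tendsto (fun n => C (x n) - μ n • y n) atTop (𝓝 (C a)) := by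
    have h1 : Tendsto (fun n => μ n • y n) atTop (𝓝 0) := by
      refine squeeze_zero_norm (a := fun n => μ n * Y) (fun n => ?_) (by
        simpa using hμlim.mul_const Y)
      rw [norm_smul, Real.norm_of_nonneg (hμ0 n).le]
      exact mul_le_mul_of_nonneg_left (hY n) (hμ0 n).le
    simpa using ((C.continuous.tendsto a).comp ha).sub h1
  refine ⟨a, b, hG.mem fun e d hd => ?_, ?_⟩
  -- The first arguments converge strongly and `y n` weakly, so the pairing passes to the limit and
  -- maximality applies.
  · have h1 : Tendsto (fun n => ⟪C (x n) - μ n • y n - C a, y n - e⟫_ℝ) atTop (𝓝 0) := by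
      refine squeeze_zero_norm (a := fun n => ‖C (x n) - μ n • y n - C a‖ * (Y + ‖e‖))
        (fun n => ?_) ?_
      · refine (norm_inner_le_norm _ _).trans ?_
        gcongr
        exact (norm_sub_le _ _).trans (by gcongr; exact hY n)
      · simpa using ((hu.sub_const (C a)).norm.mul_const (Y + ‖e‖))
    have h2 : Tendsto (fun n => ⟪C a - d, y n - e⟫_ℝ) (hyperfilter ℕ) (𝓝 ⟪C a - d, b - e⟫_ℝ) := by
      simp only [inner_sub_right (C a - d)]
      simp only [real_inner_comm _ (C a - d)]
      exact (hb _).sub_const _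
    have h3 := (h1.mono_left hle).add h2
    rw [zero_add] at h3
    refine ge_of_tendsto' h3 fun n => ?_
    rw [← inner_add_left, sub_add_sub_cancel]
    exact hG.1 _ _ _ (hy n) _ hd
  · refine ext_inner_right ℝ fun z => ?_
    have h1 : Tendsto (fun n => ⟪x n, z⟫_ℝ + t * ⟪y n, C z⟫_ℝ) (hyperfilter ℕ)
        (𝓝 (⟪a, z⟫_ℝ + t * ⟪b, C z⟫_ℝ)) :=
      ((ha.mono_left hle).inner tendsto_const_nhds).add ((hb (C z)).const_mul t)
    have h2 : ∀ (p : H₁) (q : H₂), ⟪p + t • C† q, z⟫_ℝ = ⟪p, z⟫_ℝ + t * ⟪q, C z⟫_ℝ := by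
      intro p q
      rw [inner_add_left, inner_smul_left, ContinuousLinearMap.adjoint_inner_left,
        RCLike.conj_to_real]
    simp only [← h2, hx] at h1
    exact tendsto_nhds_unique h1 tendsto_const_nhds |>.symm ▸ rfl

end Composition
-- Consequences of passivity
section Passive

variable {H₁ H₂ : Type*}
  [NormedAddCommGroup H₁] [InnerProductSpace ℝ H₁] [CompleteSpace H₁]
  [NormedAddCommGroup H₂] [InnerProductSpace ℝ H₂] [CompleteSpace H₂]
  {P : H₁ →L[ℝ] H₁} {f : H₁ → H₁} {B : H₂ →L[ℝ] H₁} {C : H₁ →L[ℝ] H₂} {D : H₂ →L[ℝ] H₂}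
  {F : H₂ → Set H₂}

local postfix:max "†" => ContinuousLinearMap.adjoint

theorem mem_operatorH {x u : H₁} :
    u ∈ operatorH P f B C D F x ↔ ∃ y ∈ inv (invAdd F D) (C x), P (f x) + P (B y) = u := by
  simp [operatorH, Set.singleton_add, Set.image_image]

theorem IsPassive.inner_self_nonneg (h : IsPassive P f B C D) (y : H₂) : 0 ≤ ⟪D y, y⟫_ℝ := by
  simpa using h.2 0 0 y 0

/-- Moving the state by `-s q`, with `q` the image of `k`, makes the linear term `-s ‖q‖²`, while
the `f` term is `O(s²)`; letting `s → 0` kills `q`. -/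
theorem IsPassive.comp_sub_adjoint_eq_zero (h : IsPassive P f B C D) {L : ℝ≥0}
    (hf : LipschitzWith L f) {k : H₂} (hk : ⟪D k, k⟫_ℝ ≤ 0) : (P ∘L B - C†) k = 0 := by
  set q := (P ∘L B - C†) k with hq
  have key : ∀ s : ℝ, 0 < s → ‖q‖ ^ 2 ≤ s * (‖P‖ * L * ‖q‖ ^ 2) := by
    intro s hs
    have h1 := h.2 (-(s • q)) 0 k 0
    simp only [sub_zero, inner_neg_right, inner_smul_right, ← hq, real_inner_self_eq_norm_sq]
      at h1
    have h3 : -⟪P (f (-(s • q)) - f 0), q⟫_ℝ ≤ ‖P‖ * (L * (s * ‖q‖)) * ‖q‖ := by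
      refine (neg_le_abs _).trans ((abs_real_inner_le_norm _ _).trans ?_)
      gcongr
      refine (P.le_opNorm _).trans ?_
      gcongr
      have := hf.norm_sub_le (-(s • q)) 0
      rwa [sub_zero, norm_neg, norm_smul, Real.norm_of_nonneg hs.le] at this
    have h4 : s * ‖q‖ ^ 2 ≤ s * (s * (‖P‖ * L * ‖q‖ ^ 2)) := by
      have := mul_le_mul_of_nonneg_left h3 hs.le
      linarith
    exact le_of_mul_le_mul_left h4 hs
  have hT : Tendsto (fun s : ℝ => s * (‖P‖ * L * ‖q‖ ^ 2)) (𝓝[>] 0) (𝓝 0) := by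
    have : Continuous fun s : ℝ => s * (‖P‖ * L * ‖q‖ ^ 2) := by fun_prop
    simpa using (this.tendsto 0).mono_left nhdsWithin_le_nhds
  have h0 : ‖q‖ ^ 2 ≤ 0 := ge_of_tendsto hT (by
    filter_upwards [self_mem_nhdsWithin] with s hs using key s hs)
  rw [← norm_eq_zero]
  exact pow_eq_zero_iff two_ne_zero |>.1 (le_antisymm h0 (sq_nonneg _))

theorem IsPassive.isMonotone_operatorH (h : IsPassive P f B C D) (hF : IsMonotone F) :
    IsMonotone (operatorH P f B C D F) := by
  rintro x₁ x₂ u₁ hu₁ u₂ hu₂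
  obtain ⟨y₁, hy₁, rfl⟩ := mem_operatorH.1 hu₁
  obtain ⟨y₂, hy₂, rfl⟩ := mem_operatorH.1 hu₂
  have h1 := h.2 x₁ x₂ y₁ y₂
  have h2 := inner_le_of_mem_inv_invAdd hF hy₁ hy₂
  have h3 : ⟪C† (y₁ - y₂), x₁ - x₂⟫_ℝ = ⟪C x₁ - C x₂, y₁ - y₂⟫_ℝ := by
    rw [ContinuousLinearMap.adjoint_inner_left, map_sub, real_inner_comm]
  have e : P (f x₁) + P (B y₁) - (P (f x₂) + P (B y₂))
      = P (f x₁ - f x₂) + (P ∘L B) (y₁ - y₂) := by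
    simp only [map_sub, ContinuousLinearMap.comp_apply]; abel
  rw [sub_apply, inner_sub_left, h3] at h1
  rw [e, inner_add_left]
  linarith

end Passive
end Lure

/-! ### Maximal monotonicity of the feedback operator -/

theorem mainTheorem3 {H₁ H₂ : Type*}
    [NormedAddCommGroup H₁] [InnerProductSpace ℝ H₁] [CompleteSpace H₁]
    [NormedAddCommGroup H₂] [InnerProductSpace ℝ H₂] [CompleteSpace H₂]
    (P : H₁ →L[ℝ] H₁) (f : H₁ → H₁) (B : H₂ →L[ℝ] H₁) (C : H₁ →L[ℝ] H₂)
    (D : H₂ →L[ℝ] H₂) (F : H₂ → Set H₂) (Lf : ℝ≥0)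
    (hf : LipschitzWith Lf f)
    (hpassive : Lure.IsPassive P f B C D)
    (hD : Lure.IsSemiCoercive D)
    (hF : Lure.IsMaximalMonotone F)
    (hri : (0 : H₂) ∈ Lure.relInterior (Set.range C - Lure.rge (Lure.invAdd F D)))
    (hy₀ : ∃ y₀ : H₂, ∀ x : H₁, C x ∈ Lure.rge (Lure.invAdd F D) →
      (({y₀} + Set.range (D + ContinuousLinearMap.adjoint D)) ∩
        Lure.inv (Lure.invAdd F D) (C x)).Nonempty) :
    Lure.IsMaximalMonotone (Lure.operatorH P f B C D F) := by
  set N := P ∘L B - ContinuousLinearMap.adjoint C with hN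
  set Φ := Lure.inv (Lure.invAdd F D)
  set A : H₁ → Set H₁ := fun x => ContinuousLinearMap.adjoint C '' Φ (C x)
  have hG : Lure.IsMaximalMonotone (Lure.invAdd F D) := hF.invAdd hpassive.inner_self_nonneg
  have hA : Lure.IsMonotone A := by
    rintro x₁ x₂ _ ⟨y₁, hy₁, rfl⟩ _ ⟨y₂, hy₂, rfl⟩
    have h := hG.1.inv _ _ _ hy₁ _ hy₂
    rwa [← map_sub, ← ContinuousLinearMap.adjoint_inner_left, map_sub] at h
  obtain ⟨c, hc, hcoer⟩ := hD
  obtain ⟨y₀, hy₀⟩ := hy₀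
  have hsel : ∀ x, ∃ y, (A x).Nonempty →
      y ∈ Φ (C x) ∧ ∃ v, y = y₀ + (D + ContinuousLinearMap.adjoint D) v := by
    intro x
    by_cases hx : (A x).Nonempty
    · obtain ⟨_, y', hy', rfl⟩ := hx
      obtain ⟨y, ⟨_, rfl, _, ⟨v, rfl⟩, rfl⟩, hy⟩ := hy₀ x (Set.mem_iUnion.2 ⟨y', hy'⟩)
      exact ⟨_, fun _ => ⟨hy, v, rfl⟩⟩
    -- The value outside the domain of `A` is immaterial: the Lipschitz bound is needed only on the
    -- domain.
    · exact ⟨0, fun h => absurd h hx⟩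
  choose h hh using hsel
  have hlip : ∀ x₁ x₂, (A x₁).Nonempty → (A x₂).Nonempty →
      ‖h x₁ - h x₂‖ ≤ c⁻¹ * ‖C‖ * ‖x₁ - x₂‖ := by
    intro x₁ x₂ hx₁ hx₂
    obtain ⟨h1, v₁, e1⟩ := hh x₁ hx₁
    obtain ⟨h2, v₂, e2⟩ := hh x₂ hx₂
    have h3 := hcoer (h x₁ - h x₂) ⟨v₁ - v₂, by rw [e1, e2, map_sub]; abel⟩
    have h4 := Lure.inner_le_of_mem_inv_invAdd hF.1 h1 h2
    have h5 : ⟪C x₁ - C x₂, h x₁ - h x₂⟫_ℝ ≤ ‖C‖ * ‖x₁ - x₂‖ * ‖h x₁ - h x₂‖ := by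
      refine (real_inner_le_norm _ _).trans ?_
      rw [← map_sub]
      gcongr
      exact C.le_opNorm _
    rw [mul_assoc, ← div_eq_inv_mul, le_div_iff₀ hc]
    by_contra! hlt
    have hpos : 0 < ‖h x₁ - h x₂‖ := by
      by_contra! h0
      have : 0 ≤ ‖C‖ * ‖x₁ - x₂‖ := by positivity
      nlinarith
    nlinarith
  set K : ℝ := ‖P‖ * Lf + ‖N‖ * (c⁻¹ * ‖C‖) with hK
  have hK0 : 0 ≤ K := by positivity
  set t : ℝ := 1 / (K + 1) with ht
  have ht0 : 0 < t := by positivity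
  have htK : t * K < 1 := by
    rw [ht, one_div_mul_eq_div, div_lt_one (by positivity)]
    linarith
  refine Lure.isMaximalMonotone_of_surjective (hpassive.isMonotone_operatorH hF.1) ht0 fun w => ?_
  obtain ⟨x, _, ⟨y, hy, rfl⟩, hxw⟩ := hA.surjective_add_of_lipschitz ht0
    (fun w => by
      obtain ⟨x, y, hy, hxy⟩ := hG.surjective_adjoint_comp hri ht0 w
      exact ⟨x, _, ⟨y, hy, rfl⟩, hxy⟩)
    (g := fun x => P (f x) + N (h x)) (K := K) (fun x₁ x₂ hx₁ hx₂ => by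
      rw [add_sub_add_comm, ← map_sub, ← map_sub, hK, add_mul]
      refine (norm_add_le _ _).trans (add_le_add ?_ ?_)
      · rw [mul_assoc]
        exact (P.le_opNorm _).trans (by gcongr; exact hf.norm_sub_le _ _)
      · rw [mul_assoc]
        exact (N.le_opNorm _).trans (by gcongr; exact hlip _ _ hx₁ hx₂))
    htK hK0 w
  refine ⟨x, _, Lure.mem_operatorH.2 ⟨y, hy, rfl⟩, ?_⟩
  -- The solution `y` need not be the selected `h x`, but `N` does not distinguish them, so `Cᵀ y +
  -- N (h x) = P B y`.
  have h1 : N (y - h x) = 0 := by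
    refine hpassive.comp_sub_adjoint_eq_zero hf ?_
    have := Lure.inner_le_of_mem_inv_invAdd hF.1 hy (hh x ⟨_, y, hy, rfl⟩).1
    simpa using this
  rw [map_sub, sub_eq_zero] at h1
  rw [← h1, hN] at hxw
  rw [← hxw]
  congr 2
  simp only [sub_apply, ContinuousLinearMap.comp_apply]
  abel
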